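/- Let $E=\{z\in\mathbb C:|z|<1\}$. Let $S_H$ be the class of harmonic, sense-preserving ($|h'|^2-|g'|^2>0$ in $E$), univalent mappings $f=h+\overline g$ of $E$, with $h,g$ analytic in $E$, normalized by $h(0)=g(0)=0$ and $h'(0)=1$. The convolution of $F=H+\overline G$ and $f=h+\overline g$ is $F\ast f=H\ast h+\overline{G\ast g}$, where $\left(\sum A_kz^k\right)\ast\left(\sum a_kz^k\right)=\sum A_ka_kz^k$. A set $\Omega\subseteq\mathbb C$ is convex in the horizontal direction if its intersection with every horizontal line is connected (or empty). **Theorem 2.2.** For real $a$ with $|a|<1$ let $f_a=h_a+\overline{g_a}$, where $$h_a(z)=\frac{\frac1{1+a}z-\frac12z^2}{(1-z)^2},\qquad g_a(z)=\frac{\frac a{1+a}z-\frac12z^2}{(1-z)^2},$$ i.e. the right half-plane mapping with $h_a+g_a=\frac z{1-z}$ and dilatation $g_a'/h_a'=\frac{a-z}{1-az}$. Let $n\ge1$ be an integer, let $\theta\in\mathbb R$, and let $f_n=h+\overline g$ be the right half-plane mapping with dilatation $e^{i\theta}z^n$, that is, $h$ and $g$ are the analytic functions in $E$ with $h(0)=g(0)=0$,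 $h(z)+g(z)=\frac z{1-z}$ and $g'(z)=e^{i\theta}z^nh'(z)$. If $\frac{n-2}{n+2}\le a<1$, then $(1+a)\,(f_a\ast f_n)\in S_H$ (so $f_a\ast f_n$ is harmonic, sense-preserving and univalent in $E$), and the image $(f_a\ast f_n)(E)$ is convex in the horizontal direction. -/

import Mathlib

/-- The open unit disk `E`. -/
def unitDisk : Set ℂ := Metric.ball 0 1

/-- The harmonic mapping `f = h + conj g` with analytic part `h` and co-analytic part `g`. -/
noncomputable def harmonicMap (h g : ℂ → ℂ) (z : ℂ) : ℂ := h z + (starRingEnd ℂ) (g z)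

/-- The Jacobian `|h'|² - |g'|²` of `h + conj g`. -/
noncomputable def harmonicJacobian (h g : ℂ → ℂ) (z : ℂ) : ℝ :=
  ‖deriv h z‖ ^ 2 - ‖deriv g z‖ ^ 2

/-- `f = h + conj g` belongs to the class `S_H`: it is harmonic, sense-preserving and univalent in
the unit disk, normalized so that `f(z) = z + ∑_{k ≥ 2} a_k z^k + conj (∑_{k ≥ 1} b_k z^k)`. -/
structure IsSH (h g : ℂ → ℂ) : Prop where
  analytic_h : DifferentiableOn ℂ h unitDisk
  analytic_g : DifferentiableOn ℂ g unitDisk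
  h_zero : h 0 = 0
  g_zero : g 0 = 0
  deriv_h_zero : deriv h 0 = 1
  sense_preserving : ∀ z ∈ unitDisk, 0 < harmonicJacobian h g z
  univalent : Set.InjOn (harmonicMap h g) unitDisk

/-- The `k`-th Taylor coefficient at the origin. -/
noncomputable def taylorCoeff (F : ℂ → ℂ) (k : ℕ) : ℂ :=
  iteratedDeriv k F 0 / (Nat.factorial k : ℂ)

/-- The Hadamard product `∑ A_k a_k z^k` of `F = ∑ A_k z^k` and `f = ∑ a_k z^k`. The convolution of
`H + conj G` and `h + conj g` is `harmonicMap (hadamard H h) (hadamard G g)`. -/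
noncomputable def hadamard (F f : ℂ → ℂ) (z : ℂ) : ℂ :=
  ∑' k : ℕ, taylorCoeff F k * taylorCoeff f k * z ^ k

/-- Every line parallel to the line joining `0` and `e^{iφ}` meets `Ω` in a connected
(possibly empty) set. -/
def ConvexInDirection (φ : ℝ) (Ω : Set ℂ) : Prop :=
  ∀ c : ℂ, IsPreconnected
    (Ω ∩ Set.range (fun t : ℝ => c + (t : ℂ) * Complex.exp ((φ : ℂ) * Complex.I)))

/-- Convexity in the horizontal direction (CHD). -/
def IsCHD (Ω : Set ℂ) : Prop := ConvexInDirection 0 Ω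

/-- The analytic part of `f_a`. -/
noncomputable def hPart (a : ℝ) (z : ℂ) : ℂ :=
  (1 / (1 + (a : ℂ)) * z - 1 / 2 * z ^ 2) / (1 - z) ^ 2

/-- The co-analytic part of `f_a`. -/
noncomputable def gPart (a : ℝ) (z : ℂ) : ℂ :=
  ((a : ℂ) / (1 + (a : ℂ)) * z - 1 / 2 * z ^ 2) / (1 - z) ^ 2

/-- `h + conj g` is the right half-plane mapping with `h + g = z / (1 - z)` and dilatation
`g' / h' = ω`. The normalization `h 0 = 0` (hence `g 0 = 0`) makes `h` and `g` unique on the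
disk. The dilatation equation is written as `g' = ω h'`; since `h' + g' = 1 / (1 - z)^2`,
it forces `h' ≠ 0` on the disk. -/
structure IsRightHalfPlaneMapping (h g ω : ℂ → ℂ) : Prop where
  analytic_h : DifferentiableOn ℂ h unitDisk
  analytic_g : DifferentiableOn ℂ g unitDisk
  h_zero : h 0 = 0
  add_eq : ∀ z ∈ unitDisk, h z + g z = z / (1 - z)
  dilatation : ∀ z ∈ unitDisk, deriv g z = ω z * deriv h z

/-! Convolution with `hPart a` and `gPart a` is a first-order differential operator, so the scaled
convolution has parts `H = ((1+a)h + (1-a)zh')/2` and `G = ((1+a)g - (1-a)zg')/2`. Logarithmic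
differentiation of `h' (1+ω)(1-z)² = 1` gives `H' = h'(κ + Q)` and `G' = -ω h'(Q - κ)`, where `Re Q
> 0` and `κ` is a real constant; the lower bound on `a` says exactly that `κ ≥ 0`. Hence `|Q - κ| ≤
|Q + κ|` and `|G'| < |H'|`.

Univalence and convexity come from shearing (`injOn_and_isCHD_of_halfPlane`). In the coordinate `w =
z/(1-z)` the disk is a half plane, and the `w`-derivative of `Φ = H - G` is `Q + κ(1-ω)/(1+ω)`,
whose real part is bounded below by a positive constant on each vertical line. So each level set of
`Im Φ`, which equals `Im (H + conj G)`, is a connected graph over the real axis direction, and along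
it `Re (H + G)` is strictly monotone in `Re Φ`. -/

/-! ### Taylor coefficients and convolution as a differential operator. -/

theorem isOpen_unitDisk : IsOpen unitDisk := Metric.isOpen_ball

theorem mem_unitDisk {z : ℂ} : z ∈ unitDisk ↔ ‖z‖ < 1 := mem_ball_zero_iff

theorem zero_mem_unitDisk : (0 : ℂ) ∈ unitDisk := by simp [mem_unitDisk]

theorem one_sub_ne_zero_of_mem_unitDisk {z : ℂ} (hz : z ∈ unitDisk) : 1 - z ≠ 0 := by
  intro h
  rw [← sub_eq_zero.mp h, mem_unitDisk] at hz
  simp at hz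

theorem taylorCoeff_eq_of_hasSum {F : ℂ → ℂ} {c : ℕ → ℂ}
    (hF : ∀ z ∈ unitDisk, HasSum (fun k => c k * z ^ k) (F z)) (k : ℕ) :
    taylorCoeff F k = c k := by
  have h1 : HasFPowerSeriesAt F (FormalMultilinearSeries.ofScalars ℂ c) 0 := by
    rw [hasFPowerSeriesAt_iff]
    filter_upwards [isOpen_unitDisk.mem_nhds zero_mem_unitDisk] with z hz
    simpa [FormalMultilinearSeries.coeff_ofScalars, mul_comm] using hF z hz
  have h2 := h1.eq_formalMultilinearSeries h1.analyticAt.hasFPowerSeriesAt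
  have h3 := congrArg (fun p => FormalMultilinearSeries.coeff p k) h2
  simpa [FormalMultilinearSeries.coeff_ofScalars, taylorCoeff] using h3.symm

theorem hasSum_taylorCoeff {F : ℂ → ℂ} (hF : DifferentiableOn ℂ F unitDisk) {z : ℂ}
    (hz : z ∈ unitDisk) : HasSum (fun k => taylorCoeff F k * z ^ k) (F z) := by
  have h1 := Complex.hasSum_taylorSeries_on_ball hF hz
  convert! h1 using 2 with k
  simp [taylorCoeff, div_eq_mul_inv]
  ring

theorem hasSum_natCast_mul_taylorCoeff {F : ℂ → ℂ} (hF : DifferentiableOn ℂ F unitDisk) {z : ℂ}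
    (hz : z ∈ unitDisk) :
    HasSum (fun k : ℕ => (k : ℂ) * taylorCoeff F k * z ^ k) (z * deriv F z) := by
  have h1 := (hasSum_taylorCoeff (hF.deriv isOpen_unitDisk) hz).mul_left z
  rw [← hasSum_nat_add_iff' 1]
  convert! h1 using 1
  · funext k
    have hk : ((k.factorial : ℕ) : ℂ) ≠ 0 := by exact_mod_cast k.factorial_ne_zero
    have hk' : (k : ℂ) + 1 ≠ 0 := by exact_mod_cast k.succ_ne_zero
    simp only [taylorCoeff, iteratedDeriv_succ', Nat.factorial_succ]
    push_cast
    field_simp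
    ring
  · simp

/-- Convolution with `β / (1 - z) + γ z / (1 - z)²`, whose Taylor coefficients are `β + γ k`. -/
theorem hadamard_eq_add_mul_deriv {K F : ℂ → ℂ} {β γ : ℂ}
    (hK : ∀ z ∈ unitDisk, K z = β * (z / (1 - z)) + γ * (z / (1 - z) ^ 2))
    (hF : DifferentiableOn ℂ F unitDisk) (hF0 : F 0 = 0) {z : ℂ} (hz : z ∈ unitDisk) :
    hadamard K F z = β * F z + γ * (z * deriv F z) := by
  -- `β z/(1-z)` lacks the constant term of `β/(1-z)`; this is harmless since `F 0 = 0`.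
  have hc : ∀ k, taylorCoeff K k = β + γ * k - if k = 0 then β else 0 := by
    refine taylorCoeff_eq_of_hasSum fun w hw => ?_
    have hw1 := mem_unitDisk.mp hw
    have h1 := (((hasSum_geometric_of_norm_lt_one hw1).mul_left β).add
      ((hasSum_coe_mul_geometric_of_norm_lt_one hw1).mul_left γ)).sub (hasSum_ite_eq (0 : ℕ) β)
    convert! h1 using 1
    · funext k
      split_ifs with hk
      · simp [hk]
      · ring
    · rw [hK w hw]
      have := one_sub_ne_zero_of_mem_unitDisk hw
      field_simp
      ring
  have h0 : taylorCoeff F 0 = 0 := by simp [taylorCoeff, hF0]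
  have h2 := ((hasSum_taylorCoeff hF hz).mul_left β).add
    ((hasSum_natCast_mul_taylorCoeff hF hz).mul_left γ)
  rw [hadamard, ← h2.tsum_eq]
  congr 1
  funext k
  rw [hc]
  split_ifs with hk
  · simp [hk, h0]
  · ring

theorem hadamard_hPart {a : ℝ} (ha : 1 + a ≠ 0) {F : ℂ → ℂ}
    (hF : DifferentiableOn ℂ F unitDisk) (hF0 : F 0 = 0) {z : ℂ} (hz : z ∈ unitDisk) :
    (1 + (a : ℂ)) * hadamard (hPart a) F z =
      ((1 + a) * F z + (1 - a) * (z * deriv F z)) / 2 := by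
  have ha' : 1 + (a : ℂ) ≠ 0 := by exact_mod_cast ha
  rw [hadamard_eq_add_mul_deriv (β := 1 / 2) (γ := (1 - a) / (2 * (1 + a))) _ hF hF0 hz]
  · field_simp
  · intro w hw
    have := one_sub_ne_zero_of_mem_unitDisk hw
    rw [hPart]
    field_simp
    ring

theorem hadamard_gPart {a : ℝ} (ha : 1 + a ≠ 0) {F : ℂ → ℂ}
    (hF : DifferentiableOn ℂ F unitDisk) (hF0 : F 0 = 0) {z : ℂ} (hz : z ∈ unitDisk) :
    (1 + (a : ℂ)) * hadamard (gPart a) F z =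
      ((1 + a) * F z - (1 - a) * (z * deriv F z)) / 2 := by
  have ha' : 1 + (a : ℂ) ≠ 0 := by exact_mod_cast ha
  rw [hadamard_eq_add_mul_deriv (β := 1 / 2) (γ := -(1 - a) / (2 * (1 + a))) _ hF hF0 hz]
  · field_simp
    ring
  · intro w hw
    have := one_sub_ne_zero_of_mem_unitDisk hw
    rw [gPart]
    field_simp
    ring

/-! ### Shearing on a half plane. -/

open Filter Topology Set in
-- Noshiro–Warschawski: along the segment from `z` to `w`, `Re (conj (w-z) · f)` has derivative
-- `|w-z|² Re f' > 0`.
theorem injOn_of_re_deriv_pos {f : ℂ → ℂ} {s : Set ℂ} (hs : Convex ℝ s) (ho : IsOpen s)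
    (hf : DifferentiableOn ℂ f s) (hpos : ∀ z ∈ s, 0 < (deriv f z).re) : InjOn f s := by
  intro z hz w hw h
  by_contra hne
  have hmem : ∀ t ∈ Icc (0 : ℝ) 1, z + (t : ℂ) * (w - z) ∈ s := fun t ht => by
    simpa using hs.add_smul_sub_mem hz hw ht
  have hd : ∀ t ∈ Icc (0 : ℝ) 1, HasDerivAt
      (fun t : ℝ => ((starRingEnd ℂ) (w - z) * f (z + (t : ℂ) * (w - z))).re)
      (Complex.normSq (w - z) * (deriv f (z + (t : ℂ) * (w - z))).re) t := by
    intro t ht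
    have h1 := ((hf.differentiableAt (ho.mem_nhds (hmem t ht))).hasDerivAt)
    have h2 : HasDerivAt (fun u : ℂ => z + u * (w - z)) (w - z) (t : ℂ) := by
      simpa using ((hasDerivAt_id (t : ℂ)).mul_const (w - z)).const_add z
    have h3 := ((h1.comp (t : ℂ) h2).const_mul ((starRingEnd ℂ) (w - z))).real_of_complex
    convert! h3 using 1
    rw [mul_comm (deriv f _), ← mul_assoc, ← Complex.normSq_eq_conj_mul_self, Complex.re_ofReal_mul]
  have hmono := strictMonoOn_of_deriv_pos (convex_Icc (0 : ℝ) 1)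
    (fun t ht => (hd t ht).continuousAt.continuousWithinAt) (fun t ht => by
      rw [interior_Icc] at ht
      rw [(hd t (Ioo_subset_Icc_self ht)).deriv]
      exact mul_pos (Complex.normSq_pos.mpr (sub_ne_zero.mpr (Ne.symm hne)))
        (hpos _ (hmem t (Ioo_subset_Icc_self ht))))
  have := hmono (left_mem_Icc.mpr zero_le_one) (right_mem_Icc.mpr zero_le_one) one_pos
  simp [h] at this

theorem isCHD_iff {s : Set ℂ} : IsCHD s ↔ ∀ c : ℝ, IsPreconnected (s ∩ {z | z.im = c}) := by
  have key : ∀ c : ℂ, Set.range (fun t : ℝ => c + (t : ℂ) *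
      Complex.exp (((0 : ℝ) : ℂ) * Complex.I)) = {z | z.im = c.im} := by
    intro c
    ext z
    simp only [Set.mem_range, Set.mem_ofPred_eq]
    constructor
    · rintro ⟨t, rfl⟩
      simp
    · intro hz
      exact ⟨z.re - c.re, by apply Complex.ext <;> simp [hz]⟩
  simp only [IsCHD, ConvexInDirection, key]
  exact ⟨fun h c => by simpa using h (c * Complex.I), fun h c => h c.im⟩

open Filter Topology Set in
/-- On a half plane where the real part of the derivative of `Φ` is bounded below on vertical lines, each level set of `Im Φ` is
the graph of a continuous function of the real part. -/
theorem exists_continuousOn_level {Φ : ℂ → ℂ} {x₀ δ : ℝ} (hδ : 0 < δ)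
    (hΦ : DifferentiableOn ℂ Φ {w | x₀ < w.re})
    (hpos : ∀ w : ℂ, x₀ < w.re → δ * (w.re - x₀) ≤ (deriv Φ w).re) (c : ℝ) :
    ∃ y : ℝ → ℝ, ContinuousOn y (Ioi x₀) ∧
      ∀ x ∈ Ioi x₀, ∀ t : ℝ, (Φ (x + t * Complex.I)).im = c ↔ t = y x := by
  have ho : IsOpen {w : ℂ | x₀ < w.re} := isOpen_lt continuous_const Complex.continuous_re
  have hd : ∀ x ∈ Ioi x₀, ∀ t : ℝ, HasDerivAt (fun t : ℝ => (Φ (x + t * Complex.I)).im)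
      (deriv Φ (x + t * Complex.I)).re t := by
    intro x hx t
    have hm : (x : ℂ) + t * Complex.I ∈ {w : ℂ | x₀ < w.re} := by simpa using hx
    have h1 := (hΦ.differentiableAt (ho.mem_nhds hm)).hasDerivAt
    have h2 : HasDerivAt (fun u : ℂ => (x : ℂ) + u * Complex.I) Complex.I (t : ℂ) := by
      simpa using ((hasDerivAt_id (t : ℂ)).mul_const Complex.I).const_add (x : ℂ)
    have h3 := ((h1.comp (t : ℂ) h2).const_mul (-Complex.I)).real_of_complex
    convert! h3 using 1
    · funext u
      simp
    · simp
  have hlow : ∀ x ∈ Ioi x₀, ∀ t : ℝ, δ * (x - x₀) ≤ (deriv Φ (x + t * Complex.I)).re := by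
    intro x hx t
    simpa using hpos (x + t * Complex.I) (by simpa using hx)
  have hmono : ∀ x ∈ Ioi x₀, StrictMono (fun t : ℝ => (Φ (x + t * Complex.I)).im) := by
    intro x hx
    refine strictMono_of_deriv_pos fun t => ?_
    rw [(hd x hx t).deriv]
    exact (mul_pos hδ (sub_pos.mpr hx)).trans_le (hlow x hx t)
  have hsurj : ∀ x ∈ Ioi x₀, ∃ t : ℝ, (Φ (x + t * Complex.I)).im = c := by
    intro x hx
    have hm : 0 < δ * (x - x₀) := mul_pos hδ (sub_pos.mpr hx)
    -- The slope bound, uniform in `t`, forces `Im Φ` to both infinities along the vertical line;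
    -- mere positivity would not.
    have hmon : Monotone (fun t : ℝ => (Φ (x + t * Complex.I)).im - δ * (x - x₀) * t) := by
      have hd' : ∀ t : ℝ, HasDerivAt
          (fun t : ℝ => (Φ (x + t * Complex.I)).im - δ * (x - x₀) * t)
          ((deriv Φ (x + t * Complex.I)).re - δ * (x - x₀)) t := fun t => by
        convert! (hd x hx t).sub ((hasDerivAt_id t).const_mul (δ * (x - x₀))) using 1
        rw [mul_one]
      refine monotone_of_deriv_nonneg (fun t => (hd' t).differentiableAt) fun t => ?_
      rw [(hd' t).deriv]
      exact sub_nonneg.mpr (hlow x hx t)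
    have hlin := tendsto_id (α := ℝ) (x := atTop) |>.const_mul_atTop hm
    have hlin' := tendsto_id (α := ℝ) (x := atBot) |>.const_mul_atBot hm
    refine Continuous.surjective
      (continuous_iff_continuousAt.mpr fun t => (hd x hx t).continuousAt) ?_ ?_ c
    · refine tendsto_atTop_mono' atTop ?_
        (tendsto_atTop_add_const_left _ (Φ (x + (0 : ℝ) * Complex.I)).im hlin)
      filter_upwards [eventually_ge_atTop 0] with t ht
      have := hmon ht
      simp only [id] at this ⊢
      linarith
    · refine tendsto_atBot_mono' atBot ?_
        (tendsto_atBot_add_const_left _ (Φ (x + (0 : ℝ) * Complex.I)).im hlin')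
      filter_upwards [eventually_le_atBot 0] with t ht
      have := hmon ht
      simp only [id] at this ⊢
      linarith
  choose! y hy using hsurj
  refine ⟨y, fun x hx => ContinuousAt.continuousWithinAt ?_, fun x hx t =>
    ⟨fun h => (hmono x hx).injective (h.trans (hy x hx).symm), fun h => h ▸ hy x hx⟩⟩
  have hcont : ∀ t : ℝ, ContinuousAt (fun x : ℝ => (Φ (x + t * Complex.I)).im) x := by
    intro t
    have hm : (x : ℂ) + t * Complex.I ∈ {w : ℂ | x₀ < w.re} := by simpa using hx
    have h1 : ContinuousAt Φ ((x : ℂ) + t * Complex.I) :=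
      (hΦ.differentiableAt (ho.mem_nhds hm)).continuousAt
    exact Complex.continuous_im.continuousAt.comp
      (ContinuousAt.comp (f := fun x : ℝ => (x : ℂ) + t * Complex.I) h1 (by fun_prop))
  -- The values at heights `y x ± ε` straddle `c`, and still do for `x'` near `x`; monotonicity
  -- traps `y x'` between these heights.
  rw [Metric.continuousAt_iff']
  intro ε hε
  have hlo : (Φ (x + (y x - ε : ℝ) * Complex.I)).im < c :=
    (hmono x hx (sub_lt_self _ hε)).trans_eq (hy x hx)
  have hhi : c < (Φ (x + (y x + ε : ℝ) * Complex.I)).im :=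
    (hy x hx).symm.trans_lt (hmono x hx (lt_add_of_pos_right _ hε))
  filter_upwards [(hcont _).eventually_lt_const hlo, (hcont _).eventually_const_lt hhi,
    Ioi_mem_nhds hx] with x' h1 h2 hx'
  rw [← hy x' hx'] at h1 h2
  have h3 := (hmono x' hx').lt_iff_lt.mp h1
  have h4 := (hmono x' hx').lt_iff_lt.mp h2
  rw [Real.dist_eq, abs_lt]
  constructor <;> linarith

theorem re_add_div_sub_pos {p q : ℂ} (h : ‖q‖ < ‖p‖) : 0 < ((p + q) / (p - q)).re := by
  have hne : p - q ≠ 0 := fun h0 => by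
    rw [sub_eq_zero.mp h0] at h
    exact lt_irrefl _ h
  have h1 : ((p + q) / (p - q)).re = (‖p‖ ^ 2 - ‖q‖ ^ 2) / Complex.normSq (p - q) := by
    rw [← Complex.normSq_eq_norm_sq, ← Complex.normSq_eq_norm_sq, Complex.div_re, ← add_div]
    congr 1
    simp [Complex.normSq_apply]
    ring
  rw [h1]
  exact div_pos (by nlinarith [norm_nonneg q]) (Complex.normSq_pos.mpr hne)

open Filter Topology Set in
/-- Shearing on a half plane in the horizontal direction. -/
theorem injOn_and_isCHD_of_halfPlane {H G : ℂ → ℂ} {x₀ δ : ℝ} (hδ : 0 < δ)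
    (hH : DifferentiableOn ℂ H {w | x₀ < w.re}) (hG : DifferentiableOn ℂ G {w | x₀ < w.re})
    (hlt : ∀ w : ℂ, x₀ < w.re → ‖deriv G w‖ < ‖deriv H w‖)
    (hpos : ∀ w : ℂ, x₀ < w.re → δ * (w.re - x₀) ≤ (deriv H w - deriv G w).re) :
    InjOn (harmonicMap H G) {w | x₀ < w.re} ∧
      IsCHD (harmonicMap H G '' {w | x₀ < w.re}) := by
  set Ω : Set ℂ := {w | x₀ < w.re} with hΩ
  have ho : IsOpen Ω := isOpen_lt continuous_const Complex.continuous_re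
  have hHd : ∀ w ∈ Ω, HasDerivAt H (deriv H w) w := fun w hw =>
    (hH.differentiableAt (ho.mem_nhds hw)).hasDerivAt
  have hGd : ∀ w ∈ Ω, HasDerivAt G (deriv G w) w := fun w hw =>
    (hG.differentiableAt (ho.mem_nhds hw)).hasDerivAt
  set Φ : ℂ → ℂ := fun w => H w - G w with hΦdef
  have hΦd : ∀ w ∈ Ω, HasDerivAt Φ (deriv H w - deriv G w) w := fun w hw =>
    (hHd w hw).sub (hGd w hw)
  have hΦ : DifferentiableOn ℂ Φ Ω := hH.sub hG
  have hΦpos : ∀ w : ℂ, x₀ < w.re → δ * (w.re - x₀) ≤ (deriv Φ w).re := fun w hw => by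
    rw [(hΦd w hw).deriv]
    exact hpos w hw
  have hinj : InjOn Φ Ω := injOn_of_re_deriv_pos (convex_halfSpace_re_gt x₀) ho hΦ fun w hw =>
    (mul_pos hδ (sub_pos.mpr hw)).trans_le (hΦpos w hw)
  have him : ∀ w, (harmonicMap H G w).im = (Φ w).im := fun w => by
    simp [harmonicMap, hΦdef, sub_eq_add_neg]
  have hre : ∀ w, (harmonicMap H G w).re = (H w + G w).re := fun w => by simp [harmonicMap]
  have hcontF : ContinuousOn (harmonicMap H G) Ω :=
    hH.continuousOn.add (Complex.continuous_conj.comp_continuousOn hG.continuousOn)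
  have hcurve : ∀ c : ℝ, IsPreconnected (Ω ∩ {w | (Φ w).im = c}) := by
    intro c
    obtain ⟨y, hyc, hy⟩ := exists_continuousOn_level hδ hΦ hΦpos c
    have : Ω ∩ {w | (Φ w).im = c} = (fun x : ℝ => (x : ℂ) + y x * Complex.I) '' Ioi x₀ := by
      ext w
      constructor
      · rintro ⟨hw, hc⟩
        refine ⟨w.re, hw, ?_⟩
        have := (hy w.re hw w.im).mp (by rwa [Complex.re_add_im])
        simp only [← this, Complex.re_add_im]
      · rintro ⟨x, hx, rfl⟩
        exact ⟨by simpa [hΩ] using hx, (hy x hx (y x)).mpr rfl⟩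
    rw [this]
    exact isPreconnected_Ioi.image _ (by fun_prop)
  refine ⟨fun w₁ hw₁ w₂ hw₂ heq => ?_, isCHD_iff.mpr fun c => ?_⟩
  · set c := (Φ w₁).im with hc
    have hc₂ : (Φ w₂).im = c := by rw [hc, ← him, ← him, heq]
    set J : Set ℝ := {s | ∃ w ∈ Ω, Φ w = s + c * Complex.I} with hJ
    have hJconv : Convex ℝ J := by
      have : J = (fun w => (Φ w).re) '' (Ω ∩ {w | (Φ w).im = c}) := by
        ext s
        constructor
        · rintro ⟨w, hw, hs⟩
          exact ⟨w, ⟨hw, by simp [hs]⟩, by simp [hs]⟩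
        · rintro ⟨w, ⟨hw, hs⟩, rfl⟩
          refine ⟨w, hw, ?_⟩
          rw [← hs, Complex.re_add_im]
      rw [this]
      exact ((hcurve c).image _ (Complex.continuous_re.comp_continuousOn
        (hΦ.continuousOn.mono inter_subset_left))).ordConnected.convex
    set ψ := Function.invFunOn Φ Ω with hψ
    have hleft : ∀ w ∈ Ω, ψ (Φ w) = w := fun w hw => hinj.leftInvOn_invFunOn hw
    -- The real part of the harmonic map along the level curve, parametrized by `s = Re Φ`; its
    -- derivative is `Re ((H'+G')/(H'-G')) > 0`.
    set r : ℝ → ℝ := fun s => (H (ψ (s + c * Complex.I)) + G (ψ (s + c * Complex.I))).re with hr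
    have hrd : ∀ s ∈ J, ∃ m : ℝ, 0 < m ∧ HasDerivAt r m s := by
      rintro s ⟨w, hw, hs⟩
      have hne : deriv H w - deriv G w ≠ 0 := fun h0 => by
        have := (mul_pos hδ (sub_pos.mpr hw)).trans_le (hpos w hw)
        simp [h0] at this
      have hstrict : HasStrictDerivAt Φ (deriv H w - deriv G w) w := by
        have := ((hΦ.analyticOnNhd ho) w hw).hasStrictDerivAt
        rwa [(hΦd w hw).deriv] at this
      have h1 : HasDerivAt ψ (deriv H w - deriv G w)⁻¹ (s + c * Complex.I) := by
        rw [← hs]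
        refine (hstrict.to_local_left_inverse hne ?_).hasDerivAt
        filter_upwards [ho.mem_nhds hw] with v hv using hleft v hv
      have h2 : HasDerivAt (fun u : ℂ => u + c * Complex.I) 1 (s : ℂ) :=
        (hasDerivAt_id (s : ℂ)).add_const _
      have hψs : ψ (s + c * Complex.I) = w := by rw [← hs, hleft w hw]
      have h3 : HasDerivAt (fun v => H v + G v) (deriv H w + deriv G w)
          (ψ (s + c * Complex.I)) := by
        rw [hψs]
        exact (hHd w hw).add (hGd w hw)
      have h4 := (h3.comp (s : ℂ) (h1.comp (s : ℂ) h2)).real_of_complex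
      refine ⟨_, ?_, h4⟩
      rw [mul_one, ← div_eq_mul_inv]
      exact re_add_div_sub_pos (hlt w hw)
    have hmono : StrictMonoOn r J := by
      refine strictMonoOn_of_deriv_pos hJconv (fun s hs => ?_) fun s hs => ?_
      · obtain ⟨m, -, hm⟩ := hrd s hs
        exact hm.continuousAt.continuousWithinAt
      · obtain ⟨m, hm0, hm⟩ := hrd s (interior_subset hs)
        rwa [hm.deriv]
    have hv : ∀ w ∈ Ω, (Φ w).im = c → (((Φ w).re : ℝ) : ℂ) + c * Complex.I = Φ w :=
      fun w _ h => by rw [← h, Complex.re_add_im]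
    have hrv : ∀ w ∈ Ω, (Φ w).im = c → r (Φ w).re = (harmonicMap H G w).re := fun w hw h => by
      simp only [hr, hv w hw h, hleft w hw, hre]
    have := hmono.injOn ⟨w₁, hw₁, (hv w₁ hw₁ hc.symm).symm⟩ ⟨w₂, hw₂, (hv w₂ hw₂ hc₂).symm⟩
      (by rw [hrv w₁ hw₁ hc.symm, hrv w₂ hw₂ hc₂, heq])
    exact hinj hw₁ hw₂ (Complex.ext this hc₂.symm)
  · have : harmonicMap H G '' Ω ∩ {z | z.im = c} =
        harmonicMap H G '' (Ω ∩ {w | (Φ w).im = c}) := by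
      ext z
      constructor
      · rintro ⟨⟨w, hw, rfl⟩, hc⟩
        exact ⟨w, ⟨hw, by rw [mem_ofPred_eq, ← him]; exact hc⟩, rfl⟩
      · rintro ⟨w, ⟨hw, hc⟩, rfl⟩
        exact ⟨⟨w, hw, rfl⟩, by rw [mem_ofPred_eq, him]; exact hc⟩
    rw [this]
    exact (hcurve c).image _ (hcontF.mono inter_subset_left)

/-! ### Invariance under scaling and transfer to the disk. -/

theorem IsCHD.image_ofReal_mul {s : Set ℂ} (hs : IsCHD s) {r : ℝ} (hr : r ≠ 0) :
    IsCHD ((fun z : ℂ => (r : ℂ) * z) '' s) := by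
  rw [isCHD_iff] at hs ⊢
  intro c
  have : (fun z : ℂ => (r : ℂ) * z) '' s ∩ {z | z.im = c} =
      (fun z : ℂ => (r : ℂ) * z) '' (s ∩ {z | z.im = c / r}) := by
    ext z
    constructor
    · rintro ⟨⟨w, hw, rfl⟩, hc⟩
      refine ⟨w, ⟨hw, ?_⟩, rfl⟩
      simp only [Set.mem_ofPred_eq, Complex.im_ofReal_mul] at hc ⊢
      rw [← hc, mul_div_cancel_left₀ _ hr]
    · rintro ⟨w, ⟨hw, hc⟩, rfl⟩
      refine ⟨⟨w, hw, rfl⟩, ?_⟩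
      simp only [Set.mem_ofPred_eq, Complex.im_ofReal_mul] at hc ⊢
      rw [hc, mul_div_cancel₀ _ hr]
  rw [this]
  exact (hs (c / r)).image _ (by fun_prop)

theorem IsSH.congr {h g h₁ g₁ : ℂ → ℂ} (H : IsSH h g) (hh : Set.EqOn h₁ h unitDisk)
    (hg : Set.EqOn g₁ g unitDisk) : IsSH h₁ g₁ where
  analytic_h := H.analytic_h.congr hh
  analytic_g := H.analytic_g.congr hg
  h_zero := (hh zero_mem_unitDisk).trans H.h_zero
  g_zero := (hg zero_mem_unitDisk).trans H.g_zero
  deriv_h_zero := (hh.deriv isOpen_unitDisk zero_mem_unitDisk).trans H.deriv_h_zero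
  sense_preserving := fun z hz => by
    rw [harmonicJacobian, hh.deriv isOpen_unitDisk hz, hg.deriv isOpen_unitDisk hz]
    exact H.sense_preserving z hz
  univalent := H.univalent.congr fun z hz => by simp only [harmonicMap, hh hz, hg hz]

theorem one_add_ne_zero_of_re {w : ℂ} (hw : -(1 / 2 : ℝ) < w.re) : 1 + w ≠ 0 := by
  intro h
  have := congrArg Complex.re h
  simp only [Complex.add_re, Complex.one_re, Complex.zero_re] at this
  linarith

/-- The half plane consists of the points closer to `0` than to `-1`. -/
theorem image_div_one_add : (fun w : ℂ => w / (1 + w)) '' {w | -(1 / 2 : ℝ) < w.re} = unitDisk := by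
  have key : ∀ w : ℂ, ‖w‖ < ‖1 + w‖ ↔ -(1 / 2 : ℝ) < w.re := by
    intro w
    rw [← sq_lt_sq₀ (norm_nonneg _) (norm_nonneg _), ← Complex.normSq_eq_norm_sq,
      ← Complex.normSq_eq_norm_sq, Complex.normSq_apply, Complex.normSq_apply]
    simp only [Complex.add_re, Complex.one_re, Complex.add_im, Complex.one_im]
    constructor <;> intro h <;> nlinarith
  ext z
  rw [mem_unitDisk]
  constructor
  · rintro ⟨w, hw, rfl⟩
    rw [norm_div, div_lt_one (norm_pos_iff.mpr (one_add_ne_zero_of_re hw))]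
    exact (key w).mpr hw
  · intro hz
    have hne := one_sub_ne_zero_of_mem_unitDisk (mem_unitDisk.mpr hz)
    have h1 : 1 + z / (1 - z) = 1 / (1 - z) := by field_simp; ring
    refine ⟨z / (1 - z), (key _).mp ?_, ?_⟩
    · rw [h1, norm_div, norm_div, norm_one]
      exact div_lt_div_of_pos_right hz (norm_pos_iff.mpr hne)
    · simp only [h1]
      field_simp

open Filter Topology Set in
/-- Shearing in the disk in the horizontal direction. -/
theorem injOn_and_isCHD_of_unitDisk {h g : ℂ → ℂ} {δ : ℝ} (hδ : 0 < δ)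
    (hh : DifferentiableOn ℂ h unitDisk) (hg : DifferentiableOn ℂ g unitDisk)
    (hlt : ∀ z ∈ unitDisk, ‖deriv g z‖ < ‖deriv h z‖)
    (hpos : ∀ z ∈ unitDisk,
      δ * ((1 + z) / (1 - z)).re ≤ ((1 - z) ^ 2 * (deriv h z - deriv g z)).re) :
    InjOn (harmonicMap h g) unitDisk ∧ IsCHD (harmonicMap h g '' unitDisk) := by
  set σ : ℂ → ℂ := fun w => w / (1 + w) with hσ
  have hmem : ∀ w : ℂ, -(1 / 2 : ℝ) < w.re → σ w ∈ unitDisk := fun w hw =>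
    image_div_one_add ▸ mem_image_of_mem _ hw
  have hσd : ∀ w : ℂ, -(1 / 2 : ℝ) < w.re → HasDerivAt σ ((1 - σ w) ^ 2) w := by
    intro w hw
    have hne := one_add_ne_zero_of_re hw
    convert! (hasDerivAt_id w).div ((hasDerivAt_id w).const_add 1) hne using 1
    simp only [hσ, id]
    field_simp
    ring
  have hcomp : ∀ {F : ℂ → ℂ}, DifferentiableOn ℂ F unitDisk → ∀ w : ℂ, -(1 / 2 : ℝ) < w.re →
      HasDerivAt (F ∘ σ) (deriv F (σ w) * (1 - σ w) ^ 2) w := fun hF w hw =>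
    (hF.differentiableAt (isOpen_unitDisk.mem_nhds (hmem w hw))).hasDerivAt.comp w (hσd w hw)
  obtain ⟨h1, h2⟩ := injOn_and_isCHD_of_halfPlane (H := h ∘ σ) (G := g ∘ σ) (x₀ := -(1 / 2))
    -- The factor 2 arises because `(1+z)/(1-z) = 1 + 2w` has real part `2(Re w + 1/2)`.
    (δ := 2 * δ) (by positivity)
    (fun w hw => (hcomp hh w hw).differentiableAt.differentiableWithinAt)
    (fun w hw => (hcomp hg w hw).differentiableAt.differentiableWithinAt)
    (fun w hw => by
      rw [(hcomp hh w hw).deriv, (hcomp hg w hw).deriv, norm_mul, norm_mul]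
      exact mul_lt_mul_of_pos_right (hlt _ (hmem w hw)) (norm_pos_iff.mpr
        (pow_ne_zero _ (one_sub_ne_zero_of_mem_unitDisk (hmem w hw)))))
    (fun w hw => by
      rw [(hcomp hh w hw).deriv, (hcomp hg w hw).deriv, ← sub_mul, mul_comm (_ - _)]
      refine le_of_eq_of_le ?_ (hpos _ (hmem w hw))
      have hne := one_add_ne_zero_of_re hw
      have : (1 + σ w) / (1 - σ w) = 1 + 2 * w := by
        simp only [hσ]
        rw [one_sub_div hne, one_add_div hne]
        field_simp
        ring
      rw [this]
      simp
      ring)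
  have hF : harmonicMap (h ∘ σ) (g ∘ σ) = harmonicMap h g ∘ σ := rfl
  rw [hF] at h1 h2
  rw [image_comp, image_div_one_add] at h2
  exact ⟨image_div_one_add ▸ h1.image_of_comp, h2⟩

/-- The squares differ by `4κ Re Q`. -/
theorem norm_sub_ofReal_le_norm_add {Q : ℂ} {κ : ℝ} (hκ : 0 ≤ κ) (hQ : 0 ≤ Q.re) :
    ‖Q - κ‖ ≤ ‖κ + Q‖ := by
  rw [← sq_le_sq₀ (norm_nonneg _) (norm_nonneg _), ← Complex.normSq_eq_norm_sq,
    ← Complex.normSq_eq_norm_sq, Complex.normSq_apply, Complex.normSq_apply]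
  simp
  nlinarith [mul_nonneg hκ hQ]

/-! ### Derivatives of right half-plane mappings. -/

namespace IsRightHalfPlaneMapping

variable {h g ω : ℂ → ℂ}

theorem g_zero (hf : IsRightHalfPlaneMapping h g ω) : g 0 = 0 := by
  simpa [hf.h_zero] using hf.add_eq 0 zero_mem_unitDisk

/-- Stated as a product so that it also yields `h' ≠ 0` and `1 + ω ≠ 0`. -/
theorem deriv_mul (hf : IsRightHalfPlaneMapping h g ω) {z : ℂ} (hz : z ∈ unitDisk) :
    deriv h z * ((1 + ω z) * (1 - z) ^ 2) = 1 := by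
  have hne := one_sub_ne_zero_of_mem_unitDisk hz
  have hnhds := isOpen_unitDisk.mem_nhds hz
  have h1 : HasDerivAt (fun z : ℂ => z / (1 - z)) (1 / (1 - z) ^ 2) z := by
    convert! (hasDerivAt_id z).div ((hasDerivAt_id z).const_sub 1) hne using 1
    simp
  have h2 := ((hf.analytic_h.differentiableAt hnhds).hasDerivAt.add
    (hf.analytic_g.differentiableAt hnhds).hasDerivAt)
  have h3 : deriv h z + deriv g z = 1 / (1 - z) ^ 2 := by
    refine h2.unique (h1.congr_of_eventuallyEq ?_)
    filter_upwards [hnhds] with w hw using hf.add_eq w hw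
  rw [hf.dilatation z hz, eq_div_iff (pow_ne_zero _ hne)] at h3
  linear_combination h3

theorem deriv_deriv (hf : IsRightHalfPlaneMapping h g ω) {z ω' : ℂ} (hz : z ∈ unitDisk)
    (hω : HasDerivAt ω ω' z) : deriv (deriv h) z =
      deriv h z * (2 / (1 - z) - ω' / (1 + ω z)) := by
  have hne := one_sub_ne_zero_of_mem_unitDisk hz
  have hnhds := isOpen_unitDisk.mem_nhds hz
  have hd := hf.deriv_mul hz
  have hω1 : 1 + ω z ≠ 0 := fun h0 => by simp [h0] at hd
  have h1 := (((hf.analytic_h.deriv isOpen_unitDisk).differentiableAt hnhds).hasDerivAt.mul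
    ((hω.const_add 1).mul (((hasDerivAt_id z).const_sub 1).pow 2)))
  have h2 := h1.unique ((hasDerivAt_const z (1 : ℂ)).congr_of_eventuallyEq (by
    filter_upwards [hnhds] with w hw using hf.deriv_mul hw))
  simp only [id, Pi.mul_apply, Pi.pow_apply] at h2
  norm_num at h2
  field_simp
  apply mul_left_cancel₀ hne
  linear_combination h2

end IsRightHalfPlaneMapping

theorem re_one_add_div_one_sub_pos {z : ℂ} (hz : ‖z‖ < 1) : 0 < ((1 + z) / (1 - z)).re :=
  re_add_div_sub_pos (by simpa using hz)

/-! ### The main theorem. -/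

theorem theorem2p2 (n : ℕ) (hn : 1 ≤ n) (a θ : ℝ)
    (ha : ((n : ℝ) - 2) / ((n : ℝ) + 2) ≤ a) (ha1 : a < 1)
    (h g : ℂ → ℂ)
    (hf : IsRightHalfPlaneMapping h g
      (fun z => Complex.exp ((θ : ℂ) * Complex.I) * z ^ n)) :
    IsSH (fun z => (1 + (a : ℂ)) * hadamard (hPart a) h z)
        (fun z => (1 + (a : ℂ)) * hadamard (gPart a) g z) ∧
      IsCHD (harmonicMap (hadamard (hPart a) h) (hadamard (gPart a) g) '' unitDisk) := by
  set ω : ℂ → ℂ := fun z => Complex.exp ((θ : ℂ) * Complex.I) * z ^ n with hω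
  have hn' : (1 : ℝ) ≤ n := by exact_mod_cast hn
  rw [div_le_iff₀ (by positivity)] at ha
  have ha0 : 0 < 1 + a := by nlinarith
  set b : ℝ := (1 - a) / 2 with hb
  have hb0 : 0 < b := by rw [hb]; linarith
  -- `H'/h' = 1 + b z h''/h'` with `z h''/h' = 2z/(1-z) - nω/(1+ω)`. Writing `2z/(1-z) = (1+z)/(1-z)
  -- - 1` and `ω/(1+ω) = (1 - (1-ω)/(1+ω))/2` splits this into the constant `κ` and the part `Q` of
  -- positive real part.
  set κ : ℝ := 1 - b - b * n / 2 with hκ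
  have hκ0 : 0 ≤ κ := by rw [hκ, hb]; linarith
  set H : ℂ → ℂ := fun z => ((1 + a) * h z + (1 - a) * (z * deriv h z)) / 2 with hH
  set G : ℂ → ℂ := fun z => ((1 + a) * g z - (1 - a) * (z * deriv g z)) / 2 with hG
  have hHeq : Set.EqOn (fun z => (1 + (a : ℂ)) * hadamard (hPart a) h z) H unitDisk :=
    fun z hz => hadamard_hPart ha0.ne' hf.analytic_h hf.h_zero hz
  have hGeq : Set.EqOn (fun z => (1 + (a : ℂ)) * hadamard (gPart a) g z) G unitDisk :=
    fun z hz => hadamard_gPart ha0.ne' hf.analytic_g hf.g_zero hz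
  have hωd : ∀ z, HasDerivAt ω (Complex.exp ((θ : ℂ) * Complex.I) * (n * z ^ (n - 1))) z :=
    fun z => (hasDerivAt_pow n z).const_mul _
  have hωz : ∀ z, z * (Complex.exp ((θ : ℂ) * Complex.I) * (n * z ^ (n - 1))) = n * ω z := by
    intro z
    obtain ⟨m, rfl⟩ := Nat.exists_eq_succ_of_ne_zero (Nat.one_le_iff_ne_zero.mp hn)
    simp only [hω, Nat.succ_eq_add_one, Nat.add_sub_cancel, pow_succ]
    ring
  have hω1 : ∀ z ∈ unitDisk, ‖ω z‖ < 1 := fun z hz => by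
    simp only [hω, norm_mul, Complex.norm_exp_ofReal_mul_I, one_mul, norm_pow]
    exact pow_lt_one₀ (norm_nonneg _) (mem_unitDisk.mp hz) (Nat.one_le_iff_ne_zero.mp hn)
  have hω1' : ∀ z ∈ unitDisk, 1 + ω z ≠ 0 := fun z hz h0 => by
    have := hf.deriv_mul hz
    simp [h0] at this
  set Q : ℂ → ℂ := fun z =>
    b * ((1 + z) / (1 - z)) + (b * n / 2 : ℝ) * ((1 - ω z) / (1 + ω z)) with hQ
  have hp : ∀ z ∈ unitDisk, 0 < ((1 - ω z) / (1 + ω z)).re := fun z hz => by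
    simpa [sub_eq_add_neg] using
      re_one_add_div_one_sub_pos (z := -ω z) (by simpa using hω1 z hz)
  have hq : ∀ z ∈ unitDisk, 0 < ((1 + z) / (1 - z)).re := fun z hz =>
    re_one_add_div_one_sub_pos (mem_unitDisk.mp hz)
  have hQre : ∀ z, (Q z).re =
      b * ((1 + z) / (1 - z)).re + (b * n / 2) * ((1 - ω z) / (1 + ω z)).re := fun z => by
    simp only [hQ, Complex.add_re, Complex.re_ofReal_mul]
  have hQpos : ∀ z ∈ unitDisk, 0 < (Q z).re := fun z hz => by
    rw [hQre]
    have := hp z hz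
    have := hq z hz
    positivity
  have hd : ∀ {F : ℂ → ℂ}, DifferentiableOn ℂ F unitDisk → ∀ z ∈ unitDisk,
      HasDerivAt F (deriv F z) z := fun hF z hz =>
    (hF.differentiableAt (isOpen_unitDisk.mem_nhds hz)).hasDerivAt
  have hHd : ∀ z ∈ unitDisk, HasDerivAt H (deriv h z * (κ + Q z)) z := by
    intro z hz
    have h1 := ((((hd hf.analytic_h z hz).const_mul (1 + (a : ℂ))).add
      (((hasDerivAt_id z).mul (hd (hf.analytic_h.deriv isOpen_unitDisk) z hz)).const_mul
        (1 - (a : ℂ)))).div_const 2)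
    convert! h1 using 1
    have e1 := one_sub_ne_zero_of_mem_unitDisk hz
    have e2 := hω1' z hz
    have e3 := hωz z
    rw [hf.deriv_deriv hz (hωd z)]
    simp only [hQ, hκ, hb, id]
    push_cast
    field_simp
    linear_combination (2 * (1 - (a : ℂ)) * (1 - z) * deriv h z) * e3
  have hGd : ∀ z ∈ unitDisk, HasDerivAt G (-(ω z * (deriv h z * (Q z - κ)))) z := by
    intro z hz
    have h0 : HasDerivAt (deriv g) _ z :=
      ((hωd z).mul (hd (hf.analytic_h.deriv isOpen_unitDisk) z hz)).congr_of_eventuallyEq (by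
        filter_upwards [isOpen_unitDisk.mem_nhds hz] with w hw using hf.dilatation w hw)
    have h1 := ((((hd hf.analytic_g z hz).const_mul (1 + (a : ℂ))).sub
      (((hasDerivAt_id z).mul h0).const_mul (1 - (a : ℂ)))).div_const 2)
    convert! h1 using 1
    have e1 := one_sub_ne_zero_of_mem_unitDisk hz
    have e2 := hω1' z hz
    have e3 := hωz z
    rw [hf.deriv_deriv hz (hωd z), hf.dilatation z hz]
    simp only [hQ, hκ, hb, id]
    push_cast
    field_simp
    linear_combination (2 * (1 - (a : ℂ)) * (1 - z) * deriv h z) * e3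
  have hlt : ∀ z ∈ unitDisk, ‖deriv G z‖ < ‖deriv H z‖ := by
    intro z hz
    rw [(hHd z hz).deriv, (hGd z hz).deriv, norm_neg, norm_mul (ω z), norm_mul (deriv h z),
      norm_mul (deriv h z)]
    have h1 : 0 < ‖deriv h z‖ := norm_pos_iff.mpr fun h0 => by
      have := hf.deriv_mul hz
      simp [h0] at this
    have h2 : 0 < ‖κ + Q z‖ := norm_pos_iff.mpr fun h0 => by
      have := congrArg Complex.re h0
      simp only [Complex.add_re, Complex.ofReal_re, Complex.zero_re] at this
      linarith [hQpos z hz]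
    have h3 := norm_sub_ofReal_le_norm_add hκ0 (hQpos z hz).le
    calc ‖ω z‖ * (‖deriv h z‖ * ‖Q z - κ‖) ≤ ‖ω z‖ * (‖deriv h z‖ * ‖κ + Q z‖) := by gcongr
      _ < 1 * (‖deriv h z‖ * ‖κ + Q z‖) := by
        gcongr
        exact hω1 z hz
      _ = _ := one_mul _
  have hpos : ∀ z ∈ unitDisk,
      b * ((1 + z) / (1 - z)).re ≤ ((1 - z) ^ 2 * (deriv H z - deriv G z)).re := by
    intro z hz
    have e1 := one_sub_ne_zero_of_mem_unitDisk hz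
    have e2 := hω1' z hz
    have h1 : (1 - z) ^ 2 * (deriv H z - deriv G z) =
        Q z + κ * ((1 - ω z) / (1 + ω z)) := by
      rw [(hHd z hz).deriv, (hGd z hz).deriv]
      have := hf.deriv_mul hz
      field_simp
      linear_combination (Q z * (1 + ω z) + κ * (1 - ω z)) * this
    rw [h1, Complex.add_re, Complex.re_ofReal_mul, hQre]
    have := hp z hz
    have : 0 ≤ b * n / 2 * ((1 - ω z) / (1 + ω z)).re := by positivity
    have : 0 ≤ κ * ((1 - ω z) / (1 + ω z)).re := by positivity
    linarith
  have hHdiff : DifferentiableOn ℂ H unitDisk := fun z hz =>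
    (hHd z hz).differentiableAt.differentiableWithinAt
  have hGdiff : DifferentiableOn ℂ G unitDisk := fun z hz =>
    (hGd z hz).differentiableAt.differentiableWithinAt
  obtain ⟨hinj, hchd⟩ := injOn_and_isCHD_of_unitDisk hb0 hHdiff hGdiff hlt hpos
  have hSH : IsSH H G :=
    { analytic_h := hHdiff
      analytic_g := hGdiff
      h_zero := by simp [hH, hf.h_zero]
      g_zero := by simp [hG, hf.g_zero]
      deriv_h_zero := by
        have h0 := hf.deriv_mul zero_mem_unitDisk
        have hω0 : ω 0 = 0 := by simp [hω, Nat.one_le_iff_ne_zero.mp hn]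
        rw [hω0] at h0
        rw [(hHd 0 zero_mem_unitDisk).deriv]
        simp only [hQ, hκ, hω0]
        push_cast
        linear_combination h0
      sense_preserving := fun z hz =>
        sub_pos.mpr (pow_lt_pow_left₀ (hlt z hz) (norm_nonneg _) two_ne_zero)
      univalent := hinj }
  refine ⟨hSH.congr hHeq hGeq, ?_⟩
  -- The factor `1 + a` is real, so it passes through the conjugation and dividing it out preserves
  -- horizontal lines.
  have himg : harmonicMap (hadamard (hPart a) h) (hadamard (gPart a) g) '' unitDisk =
      (fun z : ℂ => (((1 + a)⁻¹ : ℝ) : ℂ) * z) '' (harmonicMap H G '' unitDisk) := by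
    rw [Set.image_image]
    refine Set.image_congr fun z hz => ?_
    have hne : (1 + (a : ℂ)) ≠ 0 := by exact_mod_cast ha0.ne'
    simp only [harmonicMap, ← hHeq hz, ← hGeq hz, map_mul, map_add, map_one, Complex.conj_ofReal]
    push_cast
    field_simp
  rw [himg]
  exact hchd.image_ofReal_mul (inv_ne_zero ha0.ne')
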